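/- Let $\mathfrak g$ be a compact simple Lie algebra (a finite-dimensional simple real Lie algebra with negative definite Killing form), of any type; in particular the types $A_n$, $B_n$, $C_n$ and $G_2$ are included. For $A\in\mathfrak g$ let $\mathfrak C(A)=\{X\in\mathfrak g : [X,A]=0\}$. Let $A\in\mathfrak g$ be regular, let $B\in\mathfrak C(A)$, and let $\phi\colon\mathfrak g\to\mathfrak g$ be a sectional operator, i.e. a linear operator with $$[\phi(X),A]=[X,B]\qquad\text{for all } X\in\mathfrak g .$$ Consider the Mischenko--Fomenko top $$\dot X=[X,\phi(X)],\qquad X\in\mathfrak g .$$ Then every $X_0\in\mathfrak C(A)$ is a fixed point of this equation, i.e. $[X_0,\phi(X_0)]=0$, and it is Lyapunov stable: for every neighbourhood $U$ of $X_0$ there is a neighbourhood $V$ of $X_0$ such that for every $X\in V$ a solution starting at $X$ at time $0$ exists for all $t\ge 0$, and every solution on an interval $[0,T)$, $T>0$, that starts at $X$ stays in $U$. -/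

import Mathlib

open Set Filter Topology

namespace MischenkoFomenko

section Dynamics

variable {E : Type*} [AddCommGroup E] [Module ℝ E] [TopologicalSpace E] [ContinuousSMul ℝ E]

/-- `γ` solves the autonomous equation `ẋ = v x` on the time interval `s`
(with one-sided derivatives at end points belonging to `s`). -/
def IsSolutionOn (v : E → E) (γ : ℝ → E) (s : Set ℝ) : Prop :=
  ∀ t ∈ s, HasDerivWithinAt γ (v (γ t)) s t

/-- Lyapunov stability of the point `x₀` for `ẋ = v x`: for every neighbourhood `U` of `x₀` there is
a neighbourhood `V` of `x₀` such that for every initial value in `V` a solution exists for all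
`t ≥ 0`, and every solution on an interval `[0, T)` with that initial value stays in `U`. -/
def IsLyapunovStable (v : E → E) (x₀ : E) : Prop :=
  ∀ U ∈ 𝓝 x₀, ∃ V ∈ 𝓝 x₀, ∀ x ∈ V,
    (∃ γ : ℝ → E, γ 0 = x ∧ IsSolutionOn v γ (Ici 0)) ∧
    ∀ (T : ℝ) (γ : ℝ → E), 0 < T → γ 0 = x → IsSolutionOn v γ (Ico 0 T) →
      ∀ t ∈ Ico 0 T, γ t ∈ U

end Dynamics

section Algebra

variable {𝔤 : Type*} [LieRing 𝔤] [LieAlgebra ℝ 𝔤]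

/-- A real semisimple Lie algebra is compact if its Killing form is negative definite. -/
def IsCompactLieAlgebra (𝔤 : Type*) [LieRing 𝔤] [LieAlgebra ℝ 𝔤] : Prop :=
  ∀ X : 𝔤, X ≠ 0 → killingForm ℝ 𝔤 X X < 0

/-- The centralizer `ℭ(A) = {X | [X, A] = 0}`. -/
def centralizer (A : 𝔤) : Set 𝔤 := {X | ⁅X, A⁆ = 0}

/-- `φ` is a sectional operator with parameters `A`, `B`: the element `A` is regular, `B` lies in
the centralizer of `A`, and `[φ X, A] = [X, B]` for all `X`. -/
structure IsSectionalOperator [FiniteDimensional ℝ 𝔤] (φ : 𝔤 →ₗ[ℝ] 𝔤) (A B : 𝔤) : Prop where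
  regular : LieAlgebra.IsRegular ℝ A
  mem_centralizer : B ∈ centralizer A
  lie_eq : ∀ X : 𝔤, ⁅φ X, A⁆ = ⁅X, B⁆

/-- The right-hand side `X ↦ [X, φ X]` of the Mischenko–Fomenko top. -/
def topField (φ : 𝔤 →ₗ[ℝ] 𝔤) (X : 𝔤) : 𝔤 := ⁅X, φ X⁆

end Algebra

end MischenkoFomenko

namespace MischenkoFomenko

section Dynamics

open scoped NNReal

/-! Minus the Killing form `κ` is an inner product. Along the top `κ(X, X)` is constant by
invariance, and so is `κ(Z, X)` for each `Z ∈ ℭ(A)` (`killingForm_topField`). With `Z = X₀` this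
makes the field tangent to every sphere about `X₀`; trajectories keep their distance to `X₀`, which
gives global existence and stability at once. Regularity enters through commutativity of `ℭ(A)`: it
yields the linear integrals and, as `φ` preserves `ℭ(A)`, the fixed point. -/

/-- A bounded globally Lipschitz vector field on a Banach space has global solutions. -/
theorem exists_forall_hasDerivAt_of_lipschitzWith {E : Type*} [NormedAddCommGroup E]
    [NormedSpace ℝ E] [CompleteSpace E] {w : E → E} {K L : ℝ≥0} (hK : LipschitzWith K w)
    (hL : ∀ x, ‖w x‖ ≤ L) (x : E) :
    ∃ γ : ℝ → E, γ 0 = x ∧ ∀ t, HasDerivAt γ (w (γ t)) t := by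
  have key : ∀ T : ℝ, ∃ γ : ℝ → E, γ 0 = x ∧ ∀ t ∈ Ioo (-T) T, HasDerivAt γ (w (γ t)) t := by
    intro T
    rcases le_or_gt T 0 with hT | hT
    · exact ⟨fun _ ↦ x, rfl, fun t ht ↦ by linarith [ht.1, ht.2]⟩
    -- A solution of speed at most `L` stays in the ball of radius `L * T`, so `T` is unrestricted.
    · have hPL : IsPicardLindelof (fun _ : ℝ ↦ w)
          (⟨0, by constructor <;> linarith⟩ : Icc (-T) T) x (L * Real.toNNReal T) 0 L K :=
        { lipschitzOnWith := fun _ _ ↦ hK.lipschitzOnWith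
          continuousOn := fun _ _ ↦ continuousOn_const
          norm_le := fun _ _ y _ ↦ hL y
          mul_max_le := by simp [hT.le] }
      obtain ⟨γ, h0, hγ⟩ := hPL.exists_eq_forall_mem_Icc_hasDerivWithinAt₀
      exact ⟨γ, h0, fun t ht ↦
        (hγ t (Ioo_subset_Icc_self ht)).hasDerivAt (Icc_mem_nhds ht.1 ht.2)⟩
  choose γ h0 hγ using key
  have agree : ∀ {S T : ℝ}, 0 < S → S ≤ T → EqOn (γ S) (γ T) (Ioo (-S) S) := by
    intro S T hS hST
    refine ODE_solution_unique_of_mem_Ioo (v := fun _ ↦ w) (s := fun _ ↦ univ) (K := K) (t₀ := 0)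
      (fun _ _ ↦ hK.lipschitzOnWith) ⟨by linarith, hS⟩ (fun t ht ↦ ⟨hγ S t ht, mem_univ _⟩)
      (fun t ht ↦ ⟨hγ T t ⟨by linarith [ht.1], by linarith [ht.2]⟩, mem_univ _⟩) ?_
    rw [h0, h0]
  refine ⟨fun t ↦ γ (|t| + 1) t, h0 _, fun t ↦ ?_⟩
  have ht : t ∈ Ioo (-(|t| + 1)) (|t| + 1) := by
    rw [mem_Ioo, ← abs_lt]
    exact lt_add_one _
  refine (hγ (|t| + 1) t ht).congr_of_eventuallyEq ?_
  filter_upwards [Ioo_mem_nhds ht.1 ht.2] with s hs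
  have hs' : s ∈ Ioo (-(|s| + 1)) (|s| + 1) := by
    rw [mem_Ioo, ← abs_lt]
    exact lt_add_one _
  rcases le_total |s| |t| with h | h
  · exact agree (by positivity) (by linarith) hs'
  · exact (agree (by positivity) (by linarith) hs).symm

variable {E : Type*} [NormedAddCommGroup E] [InnerProductSpace ℝ E]

/-- Solutions of a vector field tangent to the spheres around `x₀` keep their distance to `x₀`. -/
theorem norm_sub_eq_of_isSolutionOn {v : E → E} {x₀ : E}
    (hv : ∀ x, inner ℝ (x - x₀) (v x) = 0) {γ : ℝ → E} {s : Set ℝ} (hs : Convex ℝ s)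
    (hγ : IsSolutionOn v γ s) {t₀ t : ℝ} (ht₀ : t₀ ∈ s) (ht : t ∈ s) :
    ‖γ t - x₀‖ = ‖γ t₀ - x₀‖ := by
  have hd : ∀ r ∈ s, HasDerivWithinAt (fun r ↦ ‖γ r - x₀‖ ^ 2) 0 s r := by
    intro r hr
    simpa [hv] using ((hγ r hr).sub_const x₀).norm_sq
  have h := hs.norm_image_sub_le_of_norm_hasDerivWithin_le (C := 0) hd (by simp) ht₀ ht
  have h' : ‖γ t - x₀‖ ^ 2 = ‖γ t₀ - x₀‖ ^ 2 := by
    simpa [sub_eq_zero] using h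
  exact (sq_eq_sq₀ (norm_nonneg _) (norm_nonneg _)).mp h'

/-- A `C¹` vector field tangent to the spheres around `x₀` is Lyapunov stable at `x₀`. -/
theorem isLyapunovStable_of_inner_eq_zero [FiniteDimensional ℝ E] {v : E → E} {x₀ : E}
    (hv : ContDiff ℝ 1 v) (hinner : ∀ x, inner ℝ (x - x₀) (v x) = 0) :
    IsLyapunovStable v x₀ := by
  intro U hU
  obtain ⟨r, hr, hrU⟩ := Metric.mem_nhds_iff.mp hU
  refine ⟨Metric.ball x₀ r, Metric.ball_mem_nhds x₀ hr, fun x hx ↦ ⟨?_, ?_⟩⟩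
  -- Cutting off makes the field bounded and Lipschitz; its solutions stay on a sphere inside the
  -- ball where `χ = 1`, so they solve the original equation.
  · let χ : ContDiffBump x₀ := ⟨r, r + 1, hr, by linarith⟩
    let w : E → E := fun y ↦ χ y • v y
    have hsupp : HasCompactSupport w := χ.hasCompactSupport.smul_right
    have hw : ContDiff ℝ 1 w := χ.contDiff.smul hv
    obtain ⟨K, hK⟩ := hw.lipschitzWith_of_hasCompactSupport hsupp one_ne_zero
    obtain ⟨C, hC⟩ := hsupp.exists_bound_of_continuous hw.continuous
    obtain ⟨γ, h0, hγ⟩ := exists_forall_hasDerivAt_of_lipschitzWith hK (L := C.toNNReal)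
      (fun y ↦ (hC y).trans (Real.le_coe_toNNReal C)) x
    refine ⟨γ, h0, fun t _ ↦ ?_⟩
    have hdist : ‖γ t - x₀‖ = ‖γ 0 - x₀‖ :=
      norm_sub_eq_of_isSolutionOn (v := w) (fun y ↦ by simp [w, inner_smul_right, hinner])
        convex_univ (fun s _ ↦ (hγ s).hasDerivWithinAt) (mem_univ _) (mem_univ _)
    have hmem : γ t ∈ Metric.closedBall x₀ χ.rIn := by
      rw [mem_closedBall_iff_norm, hdist, h0]
      exact (mem_ball_iff_norm.mp hx).le
    have hwv : w (γ t) = v (γ t) := by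
      simp [w, χ.one_of_mem_closedBall hmem]
    exact hwv ▸ (hγ t).hasDerivWithinAt
  · intro T γ hT h0 hγ t ht
    apply hrU
    rw [mem_ball_iff_norm, norm_sub_eq_of_isSolutionOn hinner (convex_Ico 0 T) hγ
      (left_mem_Ico.mpr hT) ht, h0]
    exact mem_ball_iff_norm.mp hx

/-- An inner product transported along a linear equivalence to a finite-dimensional topological
vector space is continuous there, with bounded unit ball. -/
theorem continuous_inner_self_and_isVonNBounded {E : Type*} [AddCommGroup E] [Module ℝ E]
    [FiniteDimensional ℝ E] [TopologicalSpace E] [IsTopologicalAddGroup E] [ContinuousSMul ℝ E]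
    [T2Space E] {F : Type*} [NormedAddCommGroup F] [InnerProductSpace ℝ F] (f : E ≃ₗ[ℝ] F) :
    (Continuous fun x ↦ inner ℝ (f x) (f x)) ∧
      Bornology.IsVonNBounded ℝ {x : E | RCLike.re (inner ℝ (f x) (f x)) < 1} := by
  have : FiniteDimensional ℝ F := f.finiteDimensional
  have hf : Continuous f := f.toLinearMap.continuous_of_finiteDimensional
  refine ⟨hf.inner hf, ?_⟩
  refine Bornology.IsVonNBounded.subset (fun x hx ↦ ?_) ((NormedSpace.isVonNBounded_ball ℝ F 1).image
    f.symm.toLinearMap.toContinuousLinearMap)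
  refine ⟨f x, ?_, by simp⟩
  simpa [real_inner_self_eq_norm_sq] using hx

/-- A quadratic vector field on a finite-dimensional topological vector space which is tangent to
the spheres around `x₀` of some positive definite bilinear form is Lyapunov stable at `x₀`. -/
theorem isLyapunovStable_of_bilinForm {E : Type*} [AddCommGroup E] [Module ℝ E]
    [FiniteDimensional ℝ E] [TopologicalSpace E] [IsTopologicalAddGroup E] [ContinuousSMul ℝ E]
    [T2Space E] (k : LinearMap.BilinForm ℝ E) (hsymm : ∀ x y, k x y = k y x)
    (hpos : ∀ x, x ≠ 0 → 0 < k x x) (Q : E →ₗ[ℝ] E →ₗ[ℝ] E) (x₀ : E)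
    (hQ : ∀ x, k (x - x₀) (Q x x) = 0) :
    IsLyapunovStable (fun x ↦ Q x x) x₀ := by
  let cd : InnerProductSpace.Core ℝ E :=
    { inner := fun x y ↦ k x y
      conj_inner_symm := fun x y ↦ hsymm y x
      re_inner_nonneg := fun x ↦ by
        rcases eq_or_ne x 0 with rfl | hx
        · simp
        · exact (hpos x hx).le
      add_left := fun x y z ↦ by simp
      smul_left := fun x y r ↦ by simp
      definite := fun x hx ↦ by
        by_contra h
        exact (hpos x h).ne' hx }
  -- These facts allow a norm from `k` that induces the given topology, so neighbourhoods and
  -- derivatives are unchanged.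
  obtain ⟨hcont, hbdd⟩ := @continuous_inner_self_and_isVonNBounded E _ _ _ _ _ _ _ E
    cd.toNormedAddCommGroup (InnerProductSpace.ofCore cd.toCore) (LinearEquiv.refl ℝ E)
  let : NormedAddCommGroup E := cd.toNormedAddCommGroupOfTopology hcont.continuousAt hbdd
  let : InnerProductSpace ℝ E :=
    InnerProductSpace.ofCoreOfTopology cd hcont.continuousAt hbdd
  refine isLyapunovStable_of_inner_eq_zero ?_ hQ
  exact (((LinearMap.toContinuousLinearMap : (E →ₗ[ℝ] E) ≃ₗ[ℝ] (E →L[ℝ] E)).toLinearMap ∘ₗ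
    Q).toContinuousLinearMap.contDiff).clm_apply contDiff_id

end Dynamics
section Algebra

variable {𝔤 : Type*} [LieRing 𝔤] [LieAlgebra ℝ 𝔤]

theorem killingForm_lie_left (X Y Z : 𝔤) :
    killingForm ℝ 𝔤 ⁅X, Y⁆ Z = -killingForm ℝ 𝔤 Y ⁅X, Z⁆ := by
  rw [← lie_skew, map_neg, LinearMap.neg_apply, LieModule.traceForm_apply_lie_apply]

theorem killingForm_comm (X Y : 𝔤) : killingForm ℝ 𝔤 X Y = killingForm ℝ 𝔤 Y X :=
  LieModule.traceForm_comm ℝ 𝔤 𝔤 X Y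

theorem killingForm_self_topField (φ : 𝔤 →ₗ[ℝ] 𝔤) (Y : 𝔤) :
    killingForm ℝ 𝔤 Y (topField φ Y) = 0 := by
  rw [topField, ← LieModule.traceForm_apply_lie_apply, lie_self, map_zero, LinearMap.zero_apply]

theorem IsCompactLieAlgebra.eq_zero (h : IsCompactLieAlgebra 𝔤) {X : 𝔤}
    (hX : killingForm ℝ 𝔤 X X = 0) : X = 0 := by
  by_contra hne
  exact (h X hne).ne hX

theorem IsCompactLieAlgebra.isKilling (h : IsCompactLieAlgebra 𝔤) : LieAlgebra.IsKilling ℝ 𝔤 where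
  killingCompl_top_eq_bot := by
    rw [eq_bot_iff]
    intro X hX
    rw [LieIdeal.mem_killingCompl] at hX
    exact (LieSubmodule.mem_bot X).mpr (h.eq_zero (hX X (LieSubmodule.mem_top X)))

/-- In a compact Lie algebra the kernel of `(ad A)²` is the centralizer of `A`. -/
theorem IsCompactLieAlgebra.lie_eq_zero (h : IsCompactLieAlgebra 𝔤) {A X : 𝔤}
    (hX : ⁅A, ⁅A, X⁆⁆ = 0) : ⁅A, X⁆ = 0 := by
  apply h.eq_zero
  rw [killingForm_lie_left, hX, map_zero, neg_zero]

/-- `ad A` is skew for a definite form, so its generalized kernel is its kernel. -/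
theorem IsCompactLieAlgebra.mem_engel_iff (h : IsCompactLieAlgebra 𝔤) {A X : 𝔤} :
    X ∈ LieSubalgebra.engel ℝ A ↔ ⁅A, X⁆ = 0 := by
  rw [LieSubalgebra.mem_engel_iff]
  refine ⟨fun ⟨n, hn⟩ ↦ ?_, fun hX ↦ ⟨1, by simpa using hX⟩⟩
  induction n with
  | zero => simp [show X = 0 by simpa using hn]
  | succ n ih =>
    cases n with
    | zero => simpa using hn
    | succ n =>
      apply ih
      rw [pow_succ', Module.End.mul_apply, LieAlgebra.ad_apply] at hn ⊢
      rw [pow_succ', Module.End.mul_apply, LieAlgebra.ad_apply] at hn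
      exact h.lie_eq_zero hn

/-- The Engel subalgebra of a regular element is a Cartan subalgebra. -/
theorem isCartanSubalgebra_engel_of_isRegular {K L : Type*} [Field K] [Infinite K] [LieRing L]
    [LieAlgebra K L] [FiniteDimensional K L] {x : L} (hx : LieAlgebra.IsRegular K x) :
    (LieSubalgebra.engel K x).IsCartanSubalgebra := by
  refine ⟨?_, LieSubalgebra.normalizer_engel _ _⟩
  apply LieSubalgebra.isNilpotent_of_forall_le_engel
  intro y hy
  let Ex : {LieSubalgebra.engel K z | z ∈ LieSubalgebra.engel K x} :=
    ⟨LieSubalgebra.engel K x, x, LieSubalgebra.self_mem_engel _ _, rfl⟩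
  suffices IsBot Ex from @this ⟨LieSubalgebra.engel K y, y, hy, rfl⟩
  -- Regularity gives `engel K x` the least dimension of all Engel subalgebras, hence minimality.
  apply LieAlgebra.engel_isBot_of_isMin
    (Cardinal.natCast_le_aleph0.trans (Cardinal.infinite_iff.mp ‹_›)) _ Ex le_rfl
  rintro ⟨_, y, hy, rfl⟩ hyx
  have hle : Module.finrank K (LieSubalgebra.engel K x) ≤
      Module.finrank K (LieSubalgebra.engel K y) := by
    rw [(LieAlgebra.isRegular_iff_finrank_engel_eq_rank K x).mp hx]
    exact LieAlgebra.rank_le_finrank_engel K y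
  have heq : LieSubalgebra.engel K y = LieSubalgebra.engel K x :=
    LieSubalgebra.toSubmodule_injective (Submodule.eq_of_le_of_finrank_le hyx hle)
  exact heq.ge

variable [FiniteDimensional ℝ 𝔤]

/-- In a compact Lie algebra the centralizer of a regular element is abelian. -/
theorem IsCompactLieAlgebra.lie_eq_zero_of_mem_centralizer (h : IsCompactLieAlgebra 𝔤) {A X Y : 𝔤}
    (hA : LieAlgebra.IsRegular ℝ A) (hX : X ∈ centralizer A) (hY : Y ∈ centralizer A) :
    ⁅X, Y⁆ = 0 := by
  have := h.isKilling
  have := isCartanSubalgebra_engel_of_isRegular hA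
  have mem {Z : 𝔤} (hZ : Z ∈ centralizer A) : Z ∈ LieSubalgebra.engel ℝ A := by
    rw [h.mem_engel_iff, ← lie_skew, show ⁅Z, A⁆ = 0 from hZ, neg_zero]
  exact congrArg Subtype.val
    (LieModule.IsTrivial.trivial (⟨X, mem hX⟩ : LieSubalgebra.engel ℝ A) ⟨Y, mem hY⟩)

/-- A compact Lie algebra is the sum of the centralizer of `A` and the image of `ad A`. -/
theorem IsCompactLieAlgebra.exists_eq_add_lie (h : IsCompactLieAlgebra 𝔤) (A Y : 𝔤) :
    ∃ H ∈ centralizer A, ∃ W, Y = H + ⁅A, W⁆ := by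
  have hd : Disjoint (LinearMap.ker (LieAlgebra.ad ℝ 𝔤 A))
      (LinearMap.range (LieAlgebra.ad ℝ 𝔤 A)) := by
    rw [Submodule.disjoint_def]
    rintro _ hX ⟨W, rfl⟩
    exact h.lie_eq_zero hX
  have hsup := Submodule.eq_top_of_disjoint _ _
    ((add_comm _ _).trans (LinearMap.finrank_range_add_finrank_ker _)).ge hd
  obtain ⟨H, hH, _, ⟨W, rfl⟩, rfl⟩ := Submodule.mem_sup.mp (hsup ▸ Submodule.mem_top (x := Y))
  refine ⟨H, ?_, W, rfl⟩
  change ⁅H, A⁆ = 0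
  rw [← lie_skew, show ⁅A, H⁆ = 0 from hH, neg_zero]

variable {φ : 𝔤 →ₗ[ℝ] 𝔤} {A B : 𝔤}

theorem IsSectionalOperator.map_mem_centralizer (h : IsCompactLieAlgebra 𝔤)
    (hφ : IsSectionalOperator φ A B) {H : 𝔤} (hH : H ∈ centralizer A) : φ H ∈ centralizer A :=
  (hφ.lie_eq H).trans (h.lie_eq_zero_of_mem_centralizer hφ.regular hH hφ.mem_centralizer)

/-- The Killing pairing with any element of the centralizer of `A` is a first integral of the top. -/
theorem IsSectionalOperator.killingForm_topField (h : IsCompactLieAlgebra 𝔤)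
    (hφ : IsSectionalOperator φ A B) {Z : 𝔤} (hZ : Z ∈ centralizer A) (Y : 𝔤) :
    killingForm ℝ 𝔤 Z (topField φ Y) = 0 := by
  obtain ⟨H, hH, W, rfl⟩ := h.exists_eq_add_lie A Y
  have comm {P Q : 𝔤} (hP : P ∈ centralizer A) (hQ : Q ∈ centralizer A) (R : 𝔤) :
      ⁅P, ⁅Q, R⁆⁆ = ⁅Q, ⁅P, R⁆⁆ := by
    rw [leibniz_lie, h.lie_eq_zero_of_mem_centralizer hφ.regular hP hQ, zero_lie, zero_add]
  have hA : A ∈ centralizer A := lie_self A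
  have hB := hφ.mem_centralizer
  have hZH := h.lie_eq_zero_of_mem_centralizer hφ.regular hZ hH
  have hφA (X : 𝔤) : ⁅A, φ X⁆ = ⁅B, X⁆ := by
    rw [← lie_skew, hφ.lie_eq, lie_skew]
  -- Moving `ad A` onto `φ` turns `[A, φ Y]` into `[B, Y]` and eliminates `φ`.
  have h1 : killingForm ℝ 𝔤 Z (topField φ (H + ⁅A, W⁆)) =
      -killingForm ℝ 𝔤 ⁅Z, W⁆ ⁅B, ⁅A, W⁆⁆ := by
    have hBH : ⁅B, H⁆ = 0 := h.lie_eq_zero_of_mem_centralizer hφ.regular hB hH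
    rw [topField, ← LieModule.traceForm_apply_lie_apply, lie_add, hZH, zero_add, comm hZ hA,
      killingForm_lie_left, hφA, lie_add, hBH, zero_add]
  -- A product of three commuting skew operators `ad Z`, `ad B`, `ad A` is skew, so its quadratic
  -- form vanishes.
  have h2 : killingForm ℝ 𝔤 ⁅Z, W⁆ ⁅B, ⁅A, W⁆⁆ = -killingForm ℝ 𝔤 ⁅Z, W⁆ ⁅B, ⁅A, W⁆⁆ := by
    calc killingForm ℝ 𝔤 ⁅Z, W⁆ ⁅B, ⁅A, W⁆⁆
        = -killingForm ℝ 𝔤 ⁅B, ⁅Z, W⁆⁆ ⁅A, W⁆ := by rw [killingForm_lie_left B, neg_neg]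
      _ = killingForm ℝ 𝔤 ⁅A, ⁅B, ⁅Z, W⁆⁆⁆ W := by rw [killingForm_lie_left A]
      _ = killingForm ℝ 𝔤 ⁅Z, ⁅B, ⁅A, W⁆⁆⁆ W := by
        rw [comm hA hB, comm hA hZ, comm hB hZ]
      _ = -killingForm ℝ 𝔤 ⁅Z, W⁆ ⁅B, ⁅A, W⁆⁆ := by
        rw [killingForm_lie_left, killingForm_comm]
  rw [h1]
  linarith

end Algebra

end MischenkoFomenko

theorem mainTheorem4 {𝔤 : Type*} [LieRing 𝔤] [LieAlgebra ℝ 𝔤] [FiniteDimensional ℝ 𝔤]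
    [TopologicalSpace 𝔤] [IsTopologicalAddGroup 𝔤] [ContinuousSMul ℝ 𝔤] [T2Space 𝔤]
    [LieAlgebra.IsSimple ℝ 𝔤] (hcompact : MischenkoFomenko.IsCompactLieAlgebra 𝔤)
    (φ : 𝔤 →ₗ[ℝ] 𝔤) (A B : 𝔤) (hφ : MischenkoFomenko.IsSectionalOperator φ A B)
    (X₀ : 𝔤) (hX₀ : X₀ ∈ MischenkoFomenko.centralizer A) :
    MischenkoFomenko.topField φ X₀ = 0 ∧
      MischenkoFomenko.IsLyapunovStable (MischenkoFomenko.topField φ) X₀ := by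
  refine ⟨hcompact.lie_eq_zero_of_mem_centralizer hφ.regular hX₀
    (hφ.map_mem_centralizer hcompact hX₀), ?_⟩
  refine MischenkoFomenko.isLyapunovStable_of_bilinForm (-killingForm ℝ 𝔤)
    (fun X Y ↦ congrArg Neg.neg (MischenkoFomenko.killingForm_comm X Y))
    (fun X hX ↦ neg_pos.mpr (hcompact X hX))
    ((LieModule.toEnd ℝ 𝔤 𝔤 : 𝔤 →ₗ[ℝ] Module.End ℝ 𝔤).compl₂ φ) X₀ fun X ↦ ?_
  change -killingForm ℝ 𝔤 (X - X₀) (MischenkoFomenko.topField φ X) = 0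
  rw [map_sub, LinearMap.sub_apply, MischenkoFomenko.killingForm_self_topField,
    hφ.killingForm_topField hcompact hX₀, sub_zero, neg_zero]
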